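/- A group is \emph{elementary} if it is finite or has an infinite cyclic subgroup of finite index. A \emph{geodesic segment} with endpoints $x,y$ in a metric space is the image of an isometric embedding of $[0,d(x,y)]$ that sends the endpoints of the interval to $x$ and $y$. For a subset $\mathcal A$ of a proper geodesic metric space $(\mathcal X,d)$ and $C>0$, a map $\pi\colon\mathcal X\to\mathcal A$ is a \emph{$C$-strongly contracting projection} if $d(a,\pi(a))\le C$ for all $a\in\mathcal A$ and if, for all $x,y\in\mathcal X$ with $d(\pi(x),\pi(y))>C$, every geodesic segment $\mathcal P$ with endpoints $x$ and $y$ satisfies $d(\pi(x),\mathcal P)\le C$ and $d(\pi(y),\mathcal P)\le C$. If a group $G$ acts by isometries on $\mathcal X$ and $o\in\mathcal X$ is a base point, an element $h\in G$ is \emph{strongly contracting} for $G\curvearrowright\mathcal X$ if $\mathbb Z\to\mathcal X$, $i\mapsto h^i.o$, is a quasi-geodesic (that is, there are $\lambda\ge1$ and $\epsilon\ge0$ with $\frac1\lambda|i-j|-\epsilon\le d(h^i.o,h^j.o)\le\lambda|i-j|+\epsilon$ for all $i,j$) and there is a $C>0$ such that for every geodesic segment $\mathcal P$ with endpoints in $\{h^i.o\mid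 i\in\mathbb Z\}$ there exists a $C$-strongly contracting projection $\mathcal X\to\mathcal P$. \textbf{Lemma.} For $i=1,\dots,n$, let $G_i$ be a non-elementary group acting properly discontinuously and cocompactly by isometries on a proper, based, geodesic metric space $(\mathcal X_i,d_i,o_i)$, and assume that $G_i$ contains a strongly contracting element for $G_i\curvearrowright\mathcal X_i$. Let $G=G_1\times\cdots\times G_n$, and let $\chi_i\colon G\to G_i$ be the projection to the $i$-th coordinate. Let $N$ be an infinite normal subgroup of $G$ such that $\chi_i(N)$ is infinite for all $i$. Then there exists an element $\underline h=(h_1,\dots,h_n)\in N$ such that, for every $i$, $h_i$ is a strongly contracting element for $G_i\curvearrowright\mathcal X_i$. -/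

import Mathlib

/-- A group is elementary if it is finite or has an infinite cyclic subgroup of finite index. -/
def IsElementaryGroup (G : Type*) [Group G] : Prop :=
  Finite G ∨ ∃ H : Subgroup G, Infinite H ∧ IsCyclic H ∧ H.FiniteIndex

/-- `P` is (the image of) a geodesic segment from `x` to `y`. -/
def IsGeodesicSegment {X : Type*} [MetricSpace X] (P : Set X) (x y : X) : Prop :=
  ∃ γ : ℝ → X, γ 0 = x ∧ γ (dist x y) = y ∧
    (∀ s ∈ Set.Icc 0 (dist x y), ∀ t ∈ Set.Icc 0 (dist x y), dist (γ s) (γ t) = |s - t|) ∧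
    P = γ '' Set.Icc 0 (dist x y)

/-- A metric space is geodesic if any two points are joined by a geodesic segment. -/
def IsGeodesicSpace (X : Type*) [MetricSpace X] : Prop :=
  ∀ x y : X, ∃ P : Set X, IsGeodesicSegment P x y

/-- A bi-infinite discrete path `f : ℤ → X` is a quasi-geodesic if it is a quasi-isometric
embedding. -/
def IsQuasiGeodesic {X : Type*} [MetricSpace X] (f : ℤ → X) : Prop :=
  ∃ l e : ℝ, 1 ≤ l ∧ 0 ≤ e ∧ ∀ i j : ℤ,
    |(i : ℝ) - (j : ℝ)| / l - e ≤ dist (f i) (f j) ∧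
      dist (f i) (f j) ≤ l * |(i : ℝ) - (j : ℝ)| + e

/-- `π : X → A` is a `C`-strongly contracting projection onto the subset `A` of `X`. -/
structure IsContractingProjection {X : Type*} [MetricSpace X] (C : ℝ) (A : Set X)
    (π : X → A) : Prop where
  dist_le : ∀ a : A, dist (a : X) (π a : X) ≤ C
  infDist_le : ∀ x y : X, C < dist (π x : X) (π y : X) →
    ∀ P : Set X, IsGeodesicSegment P x y →
      Metric.infDist (π x : X) P ≤ C ∧ Metric.infDist (π y : X) P ≤ C

/-- The element `h` is `C`-strongly contracting for the action of `G` on the space `X` based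
at `o`. -/
def IsStronglyContractingWith {G X : Type*} [Group G] [MetricSpace X] [MulAction G X]
    (C : ℝ) (o : X) (h : G) : Prop :=
  IsQuasiGeodesic (fun i : ℤ => h ^ i • o) ∧
    ∀ (i j : ℤ) (P : Set X), IsGeodesicSegment P (h ^ i • o) (h ^ j • o) →
      ∃ π : X → P, IsContractingProjection C P π

/-- The element `h` is strongly contracting for the action of `G` on the space `X` based
at `o`. -/
def IsStronglyContracting {G X : Type*} [Group G] [MetricSpace X] [MulAction G X]
    (o : X) (h : G) : Prop :=
  ∃ C : ℝ, 0 < C ∧ IsStronglyContractingWith C o h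

/-! Fix a coordinate `i` and a strongly contracting `f` in `G i`. The image of `N` in `G i` is an
infinite normal subgroup; since `G i` is not elementary, this image contains some `m` that
conjugates no nontrivial power of `f` to a nontrivial power of `f` (`exists_mem_not_commensurates`).
For such an `m` and suitable large `k`, the commutator of `f ^ k` and `m` is strongly contracting
(`exists_commutator`). If `m` is the `i`-th coordinate of `x ∈ N`, then the commutator of `x` with
an element supported in coordinate `i` lies in `N` and is itself supported there. Multiplying these
elements over all `i` gives the required element of `N`.

The commutator is treated by ping-pong on a segment `P` from `o` to `f ^ k • o`. Translates of axis
segments by `m` and `m⁻¹` have bounded projection, so a Behrstock inequality makes nonpositive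
powers of the commutator send `o` to points projecting near one end of `P`, and positive powers to
points projecting near the other. Translates of `P` are then lined up along the orbit, and geodesics
crossing them pass nearby; this yields the contraction (`isStronglyContracting_of_separates`). -/

/-! ### Geodesic segments -/

section Segments

variable {X : Type*} [MetricSpace X] {P : Set X} {x y z w : X}

theorem IsGeodesicSegment.symm (h : IsGeodesicSegment P x y) : IsGeodesicSegment P y x := by
  obtain ⟨γ, h0, h1, hγ, rfl⟩ := h
  refine ⟨fun t => γ (dist x y - t), ?_, ?_, ?_, ?_⟩
  · simpa using h1
  · simpa [dist_comm y x] using h0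
  · rw [dist_comm y x]
    intro s hs t ht
    rw [hγ _ ⟨by linarith [hs.2], by linarith [hs.1]⟩ _ ⟨by linarith [ht.2], by linarith [ht.1]⟩,
      abs_sub_comm]
    congr 1
    ring
  · rw [dist_comm y x]
    ext p
    constructor
    · rintro ⟨t, ht, rfl⟩
      exact ⟨dist x y - t, ⟨by linarith [ht.2], by linarith [ht.1]⟩, by simp⟩
    · rintro ⟨t, ht, rfl⟩
      exact ⟨dist x y - t, ⟨by linarith [ht.2], by linarith [ht.1]⟩, rfl⟩

theorem IsGeodesicSegment.left_mem (h : IsGeodesicSegment P x y) : x ∈ P := by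
  obtain ⟨γ, h0, h1, hγ, rfl⟩ := h
  exact ⟨0, ⟨le_rfl, dist_nonneg⟩, h0⟩

theorem IsGeodesicSegment.right_mem (h : IsGeodesicSegment P x y) : y ∈ P := h.symm.left_mem

theorem IsGeodesicSegment.dist_eq_abs (h : IsGeodesicSegment P x y) (hz : z ∈ P) (hw : w ∈ P) :
    dist z w = |dist x z - dist x w| := by
  obtain ⟨γ, h0, h1, hγ, rfl⟩ := h
  obtain ⟨s, hs, rfl⟩ := hz
  obtain ⟨t, ht, rfl⟩ := hw
  have h00 : (0 : ℝ) ∈ Set.Icc 0 (dist x y) := ⟨le_rfl, dist_nonneg⟩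
  have e1 := hγ 0 h00 s hs
  have e2 := hγ 0 h00 t ht
  rw [h0, zero_sub, abs_neg, abs_of_nonneg hs.1] at e1
  rw [h0, zero_sub, abs_neg, abs_of_nonneg ht.1] at e2
  rw [e1, e2, hγ s hs t ht]

theorem IsGeodesicSegment.dist_left_le (h : IsGeodesicSegment P x y) (hz : z ∈ P) :
    dist x z ≤ dist x y := by
  obtain ⟨γ, h0, h1, hγ, rfl⟩ := h
  obtain ⟨s, hs, rfl⟩ := hz
  have e1 := hγ 0 ⟨le_rfl, dist_nonneg⟩ s hs
  rw [h0, zero_sub, abs_neg, abs_of_nonneg hs.1] at e1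
  rw [e1]
  exact hs.2

theorem IsGeodesicSegment.dist_add (h : IsGeodesicSegment P x y) (hz : z ∈ P) :
    dist x z + dist z y = dist x y := by
  rw [h.dist_eq_abs hz h.right_mem, abs_sub_comm, abs_of_nonneg (by linarith [h.dist_left_le hz])]
  ring

theorem IsGeodesicSegment.dist_le (h : IsGeodesicSegment P x y) (hz : z ∈ P) (hw : w ∈ P) :
    dist z w ≤ dist x y := by
  have h1 := h.dist_left_le hz
  have h2 := h.dist_left_le hw
  rw [h.dist_eq_abs hz hw, abs_le]
  constructor <;> linarith [dist_nonneg (x := x) (y := z), dist_nonneg (x := x) (y := w)]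

theorem IsGeodesicSegment.isCompact (h : IsGeodesicSegment P x y) : IsCompact P := by
  obtain ⟨γ, h0, h1, hγ, rfl⟩ := h
  refine isCompact_Icc.image_of_continuousOn ?_
  refine LipschitzOnWith.continuousOn (K := 1) (LipschitzOnWith.of_dist_le_mul ?_)
  intro s hs t ht
  rw [hγ s hs t ht, Real.dist_eq]
  simp

theorem IsGeodesicSegment.exists_subsegment (h : IsGeodesicSegment P x y) (hz : z ∈ P) :
    ∃ Q ⊆ P, IsGeodesicSegment Q x z := by
  have hle := h.dist_left_le hz
  obtain ⟨γ, h0, h1, hγ, rfl⟩ := h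
  obtain ⟨s, hs, rfl⟩ := hz
  have e1 := hγ 0 ⟨le_rfl, dist_nonneg⟩ s hs
  rw [h0, zero_sub, abs_neg, abs_of_nonneg hs.1] at e1
  refine ⟨γ '' Set.Icc 0 (dist x (γ s)), Set.image_mono (Set.Icc_subset_Icc le_rfl hle), γ, h0,
    by rw [e1], fun a ha b hb => hγ a ⟨ha.1, ha.2.trans hle⟩ b ⟨hb.1, hb.2.trans hle⟩, rfl⟩

theorem IsGeodesicSegment.smul {G : Type*} [Group G] [MulAction G X] [IsIsometricSMul G X]
    (h : IsGeodesicSegment P x y) (g : G) :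
    IsGeodesicSegment ((fun p => g • p) '' P) (g • x) (g • y) := by
  obtain ⟨γ, h0, h1, hγ, rfl⟩ := h
  refine ⟨fun t => g • γ t, by simp [h0], by simp [h1], ?_, ?_⟩
  · intro s hs t ht
    rw [dist_smul] at hs ht
    rw [dist_smul]
    exact hγ s hs t ht
  · rw [dist_smul, Set.image_image]

end Segments

/-! ### Strongly contracting projections -/

/-- A version of `IsContractingProjection` for self-maps with values in `P`. -/
structure ContractsTo {X : Type*} [MetricSpace X] (C : ℝ) (P : Set X) (ρ : X → X) : Prop where
  mem : ∀ x, ρ x ∈ P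
  dist_le : ∀ a ∈ P, dist a (ρ a) ≤ C
  exists_near : ∀ x y : X, C < dist (ρ x) (ρ y) → ∀ Q : Set X, IsGeodesicSegment Q x y →
    ∃ z ∈ Q, dist z (ρ x) ≤ C

section Contraction

variable {X : Type*} [MetricSpace X] {C : ℝ} {P : Set X} {ρ : X → X}

theorem IsContractingProjection.contractsTo {π : X → P} (h : IsContractingProjection C P π) :
    ContractsTo C P (fun x => (π x : X)) where
  mem x := (π x).2
  dist_le a ha := h.dist_le ⟨a, ha⟩
  exists_near x y hxy Q hQ := by
    obtain ⟨z, hz, hd⟩ := hQ.isCompact.exists_infDist_eq_dist ⟨x, hQ.left_mem⟩ (π x : X)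
    refine ⟨z, hz, ?_⟩
    rw [dist_comm, ← hd]
    exact (h.infDist_le x y hxy Q hQ).1

/-- The one-sided condition suffices because a geodesic segment can be reversed. -/
theorem ContractsTo.exists_isContractingProjection (h : ContractsTo C P ρ) :
    ∃ π : X → P, IsContractingProjection C P π := by
  refine ⟨fun x => ⟨ρ x, h.mem x⟩, fun a => h.dist_le a a.2, fun x y hxy Q hQ => ⟨?_, ?_⟩⟩
  · obtain ⟨z, hz, hd⟩ := h.exists_near x y hxy Q hQ
    refine (Metric.infDist_le_dist_of_mem hz).trans ?_
    rwa [dist_comm]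
  · obtain ⟨z, hz, hd⟩ := h.exists_near y x (by rwa [dist_comm]) Q hQ.symm
    refine (Metric.infDist_le_dist_of_mem hz).trans ?_
    rwa [dist_comm]

theorem ContractsTo.nonneg (h : ContractsTo C P ρ) (x : X) : 0 ≤ C :=
  dist_nonneg.trans (h.dist_le _ (h.mem x))

theorem ContractsTo.smul {G : Type*} [Group G] [MulAction G X] [IsIsometricSMul G X]
    (h : ContractsTo C P ρ) (g : G) :
    ContractsTo C ((fun p => g • p) '' P) (fun x => g • ρ (g⁻¹ • x)) where
  mem x := ⟨_, h.mem _, rfl⟩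
  dist_le := by
    rintro _ ⟨a, ha, rfl⟩
    simpa using h.dist_le a ha
  exists_near x y hxy Q hQ := by
    rw [dist_smul] at hxy
    obtain ⟨_, ⟨z, hz, rfl⟩, hd⟩ := h.exists_near _ _ hxy _ (hQ.smul g⁻¹)
    refine ⟨z, hz, ?_⟩
    rwa [← dist_smul g, smul_inv_smul] at hd

theorem ContractsTo.dist_self_le (hX : IsGeodesicSpace X) (h : ContractsTo C P ρ) (x : X) {s : X}
    (hs : s ∈ P) : dist x (ρ x) ≤ dist x s + 2 * C := by
  have h0 := h.nonneg x
  have hsC := h.dist_le s hs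
  by_cases hC : C < dist (ρ x) (ρ s)
  · obtain ⟨Q, hQ⟩ := hX x s
    obtain ⟨z, hz, hd⟩ := h.exists_near x s hC Q hQ
    have := hQ.dist_left_le hz
    linarith [dist_triangle x z (ρ x)]
  · rw [not_lt, dist_comm] at hC
    linarith [dist_triangle4 x s (ρ s) (ρ x)]

theorem ContractsTo.dist_map_le (hX : IsGeodesicSpace X) (h : ContractsTo C P ρ) (x y : X) :
    dist (ρ x) (ρ y) ≤ dist x y + 2 * C := by
  have h0 := h.nonneg x
  by_cases hC : C < dist (ρ x) (ρ y)
  · obtain ⟨Q, hQ⟩ := hX x y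
    obtain ⟨z, hz, hzd⟩ := h.exists_near x y hC Q hQ
    obtain ⟨w, hw, hwd⟩ := h.exists_near y x (by rwa [dist_comm]) Q hQ.symm
    have := hQ.dist_le hz hw
    rw [dist_comm] at hzd
    linarith [dist_triangle4 (ρ x) z w (ρ y)]
  · linarith [dist_nonneg (x := x) (y := y)]

theorem ContractsTo.dist_map_mem_le (hX : IsGeodesicSpace X) (h : ContractsTo C P ρ) (x : X)
    {s : X} (hs : s ∈ P) : dist (ρ x) s ≤ 2 * dist x s + 2 * C := by
  have := h.dist_self_le hX x hs
  rw [dist_comm] at this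
  linarith [dist_triangle (ρ x) x s]

end Contraction

/-! ### Discrete paths along segments -/

section Sequences

variable {X : Type*} [MetricSpace X]

theorem exists_nat_le_le_succ (τ : ℕ → ℝ) {t : ℝ} (n : ℕ) (h0 : τ 0 ≤ t) (hn : t ≤ τ n) :
    t = τ n ∨ ∃ l < n, τ l ≤ t ∧ t ≤ τ (l + 1) := by
  induction n with
  | zero => exact Or.inl (le_antisymm hn h0)
  | succ n ih =>
    by_cases h : t ≤ τ n
    · rcases ih h with h | ⟨l, hl, h⟩
      · exact Or.inr ⟨n, by omega, h.ge, hn⟩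
      · exact Or.inr ⟨l, by omega, h⟩
    · exact Or.inr ⟨n, by omega, (not_le.mp h).le, hn⟩

/-- A geodesic segment is covered by neighbourhoods of the points of a discrete path that stays
close to it and has the same endpoints. -/
theorem IsGeodesicSegment.exists_dist_path_le {Q : Set X} {y : ℕ → X} {n : ℕ} {D s : ℝ}
    (hs0 : 0 ≤ s)
    (hQ : IsGeodesicSegment Q (y 0) (y n)) (hD : ∀ l ≤ n, ∃ q ∈ Q, dist q (y l) ≤ D)
    (hs : ∀ l < n, dist (y l) (y (l + 1)) ≤ s) {p : X} (hp : p ∈ Q) :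
    ∃ l ≤ n, dist p (y l) ≤ s + 2 * D := by
  -- Discrete intermediate values: the distance to `y 0` changes by at most `s` per step. On `Q`
  -- this distance is a coordinate, so a path point at the height of `p` is near `p`.
  have key : ∃ l ≤ n, |dist (y 0) p - dist (y 0) (y l)| ≤ s := by
    rcases exists_nat_le_le_succ (fun l => dist (y 0) (y l)) (t := dist (y 0) p) n (by simp)
      (hQ.dist_left_le hp) with h | ⟨l, hl, h1, h2⟩
    · exact ⟨n, le_rfl, by simpa [h] using hs0⟩
    · refine ⟨l, hl.le, ?_⟩
      rw [abs_of_nonneg (by linarith)]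
      linarith [hs l hl, dist_triangle (y 0) (y l) (y (l + 1))]
  obtain ⟨l, hl, h⟩ := key
  obtain ⟨q, hq, hqd⟩ := hD l hl
  refine ⟨l, hl, ?_⟩
  have e := hQ.dist_eq_abs hp hq
  have h3 : |dist (y 0) (y l) - dist (y 0) q| ≤ dist q (y l) := by
    rw [abs_le]
    constructor <;>
      linarith [dist_triangle (y 0) q (y l), dist_triangle (y 0) (y l) q, dist_comm q (y l)]
  have h4 := abs_sub_le (dist (y 0) p) (dist (y 0) (y l)) (dist (y 0) q)
  linarith [dist_triangle p q (y l)]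

theorem dist_le_of_dist_succ_le {y : ℕ → X} {s : ℝ} (hs : ∀ l, dist (y l) (y (l + 1)) ≤ s)
    (a n : ℕ) : dist (y a) (y (a + n)) ≤ n * s := by
  induction n with
  | zero => simp
  | succ n ih =>
    have := hs (a + n)
    push_cast
    rw [← add_assoc]
    linarith [dist_triangle (y a) (y (a + n)) (y (a + n + 1))]

end Sequences

/-! ### The Morse property -/

section Morse

variable {X : Type*} [MetricSpace X] {C : ℝ} {P : Set X} {ρ : X → X}

/-- Otherwise a geodesic from `x` to `y` would come `C`-close to `ρ x`, which is too far from `x`.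
-/
theorem ContractsTo.dist_map_le_of_far (hX : IsGeodesicSpace X) (h : ContractsTo C P ρ) {x y : X}
    (hxy : dist x y + C < dist x (ρ x)) : dist (ρ x) (ρ y) ≤ C := by
  by_contra! hC
  obtain ⟨Q, hQ⟩ := hX x y
  obtain ⟨z, hz, hd⟩ := h.exists_near x y hC Q hQ
  linarith [hQ.dist_left_le hz, dist_triangle x z (ρ x)]

/-- Far from `P`, each block of `N` steps moves the projection by at most `C`. -/
theorem ContractsTo.dist_map_path_le_of_far (hX : IsGeodesicSpace X) (h : ContractsTo C P ρ)
    {y : ℕ → X} {s : ℝ} (hs : ∀ l, dist (y l) (y (l + 1)) ≤ s) {N : ℕ} (hN : 0 < N) (m : ℕ) :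
    ∀ a, (∀ c, a ≤ c → c < a + m → N * s + C < dist (y c) (ρ (y c))) →
      dist (ρ (y a)) (ρ (y (a + m))) ≤ C * (m / N + 1) := by
  have hC := h.nonneg (y 0)
  have hs0 : 0 ≤ s := dist_nonneg.trans (hs 0)
  have hN' : (0 : ℝ) < N := by exact_mod_cast hN
  induction m using Nat.strong_induction_on with
  | _ m ih =>
  intro a ha
  have hshort : ∀ k ≤ N, 0 < m → dist (ρ (y a)) (ρ (y (a + k))) ≤ C := by
    intro k hk hm
    refine h.dist_map_le_of_far hX (lt_of_le_of_lt ?_ (ha a le_rfl (by omega)))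
    have h1 := dist_le_of_dist_succ_le hs a k
    have h2 : (k : ℝ) * s ≤ N * s := by gcongr
    linarith
  rcases Nat.eq_zero_or_pos m with rfl | hm
  · simpa using hC
  rcases le_or_gt m N with hmN | hmN
  · refine (hshort m hmN hm).trans ?_
    have : 0 ≤ C * (m / N : ℝ) := by positivity
    linarith
  · have h1 := hshort N le_rfl hm
    have h2 := ih (m - N) (by omega) (a + N) (fun c hc hc' => ha c (by omega) (by omega))
    rw [show a + N + (m - N) = a + m by omega, Nat.cast_sub hmN.le, sub_div, div_self hN'.ne',
      sub_add_cancel] at h2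
    linarith [dist_triangle (ρ (y a)) (ρ (y (a + N))) (ρ (y (a + m)))]

theorem exists_last_not (p : ℕ → Prop) (h0 : ¬ p 0) (l : ℕ) (hl : p l) :
    ∃ a < l, ¬ p a ∧ ∀ c, a < c → c ≤ l → p c := by
  induction l with
  | zero => exact absurd hl h0
  | succ l ih =>
    by_cases hpl : p l
    · obtain ⟨a, hal, ha, hc⟩ := ih hpl
      refine ⟨a, by omega, ha, fun c hac hcl => ?_⟩
      rcases Nat.lt_or_ge l c with h | h
      · rwa [show c = l + 1 by omega]
      · exact hc c hac h
    · refine ⟨l, by omega, hpl, fun c hac hcl => ?_⟩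
      rwa [show c = l + 1 by omega]

/-- A quasi-geodesic with endpoints in a strongly contracting set stays uniformly close to it. -/
theorem exists_morse_constant (hX : IsGeodesicSpace X) (C lam ε s : ℝ) (hlam : 1 ≤ lam) :
    ∃ D : ℝ, 0 ≤ D ∧ ∀ (P : Set X) (ρ : X → X), ContractsTo C P ρ → ∀ y : ℕ → X,
      (∀ l, dist (y l) (y (l + 1)) ≤ s) →
      (∀ a b : ℕ, a ≤ b → ((b : ℝ) - a) / lam - ε ≤ dist (y a) (y b)) →
      ∀ n, y 0 ∈ P → y n ∈ P → ∀ l ≤ n, ∃ q ∈ P, dist q (y l) ≤ D := by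
  -- With this `N`, the projection of a far path moves at speed at most `C / N < 1 / (2 * lam)`,
  -- less than half the rate in the lower bound. An excursion beyond `D₀` therefore lasts at most
  -- `L` steps.
  obtain ⟨N, hN⟩ := exists_nat_ge (2 * lam * C + 1)
  set D₀ : ℝ := N * s + C with hD₀
  set L : ℝ := 2 * lam * (2 * D₀ + s + 3 * C + ε) with hL
  refine ⟨|L * s| + |D₀|, by positivity, ?_⟩
  intro P ρ h y hs hlow n h0 hn l hl
  have hC := h.nonneg (y 0)
  have hs0 : 0 ≤ s := dist_nonneg.trans (hs 0)
  have hN1 : (1 : ℝ) ≤ N := by nlinarith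
  have hN0 : 0 < N := by
    have : (0 : ℝ) < N := by linarith
    exact_mod_cast this
  have hD0C : C ≤ D₀ := by
    have : 0 ≤ N * s := by positivity
    linarith
  by_cases hfar : D₀ < dist (y l) (ρ (y l))
  swap
  · refine ⟨ρ (y l), h.mem _, ?_⟩
    rw [dist_comm]
    linarith [le_abs_self D₀, abs_nonneg (L * s), not_lt.mp hfar]
  have hnear0 : ¬ D₀ < dist (y 0) (ρ (y 0)) := not_lt.mpr ((h.dist_le _ h0).trans hD0C)
  have hnearn : ¬ D₀ < dist (y n) (ρ (y n)) := not_lt.mpr ((h.dist_le _ hn).trans hD0C)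
  obtain ⟨a, hal, ha, hac⟩ := exists_last_not (fun l => D₀ < dist (y l) (ρ (y l))) hnear0 l hfar
  have hex : ∃ b, l < b ∧ ¬ D₀ < dist (y b) (ρ (y b)) := by
    refine ⟨n, lt_of_le_of_ne hl ?_, hnearn⟩
    rintro rfl
    exact hnearn hfar
  classical
  obtain ⟨hlb, hb⟩ := Nat.find_spec hex
  have hmin := fun c => Nat.find_min hex (m := c)
  set b := Nat.find hex
  have hfarc : ∀ c, a < c → c < b → D₀ < dist (y c) (ρ (y c)) := by
    intro c hac' hcb
    rcases Nat.lt_or_ge l c with h1 | h1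
    · have := hmin c hcb
      by_contra h2
      exact this ⟨h1, h2⟩
    · exact hac c hac' h1
  have h1 := h.dist_map_path_le_of_far hX hs hN0 (b - (a + 1)) (a + 1)
    (fun c hc hc' => hfarc c (by omega) (by omega))
  rw [show a + 1 + (b - (a + 1)) = b by omega] at h1
  have h2 := (h.dist_map_le hX (y a) (y (a + 1))).trans (add_le_add_left (hs a) _)
  have hab : (a : ℝ) + 1 ≤ b := by exact_mod_cast (by omega : a + 1 ≤ b)
  have h3 : C * (((b - (a + 1) : ℕ) : ℝ) / N + 1) ≤ ((b : ℝ) - a) / (2 * lam) + C := by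
    rw [Nat.cast_sub (by omega), mul_add, mul_one]
    have : C * (((b : ℝ) - ((a + 1 : ℕ) : ℝ)) / N) ≤ ((b : ℝ) - a) / (2 * lam) := by
      rw [← mul_div_assoc, div_le_div_iff₀ (by linarith) (by linarith)]
      push_cast
      have e1 : 0 ≤ 2 * lam * C := by positivity
      nlinarith
    linarith
  have h4 := hlow a b (by omega)
  have h5 : ((b : ℝ) - a) / lam = 2 * (((b : ℝ) - a) / (2 * lam)) := by
    field_simp
  have h6 : dist (y a) (y b) ≤ 2 * D₀ + dist (ρ (y a)) (ρ (y b)) := by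
    rw [not_lt] at ha hb
    rw [dist_comm] at hb
    linarith [dist_triangle4 (y a) (ρ (y a)) (ρ (y b)) (y b)]
  have h7 := dist_triangle (ρ (y a)) (ρ (y (a + 1))) (ρ (y b))
  have h8 : ((b : ℝ) - a) / (2 * lam) ≤ 2 * D₀ + s + 3 * C + ε := by linarith
  have h9 : (b : ℝ) - a ≤ L := by
    rw [div_le_iff₀ (by linarith)] at h8
    rw [hL]
    linarith
  refine ⟨ρ (y a), h.mem _, ?_⟩
  have h10 := dist_le_of_dist_succ_le hs a (l - a)
  rw [show a + (l - a) = l by omega, Nat.cast_sub hal.le] at h10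
  have h11 : ((l : ℝ) - a) * s ≤ L * s := by
    have : (l : ℝ) ≤ b := by exact_mod_cast hlb.le
    gcongr
    linarith
  rw [not_lt, dist_comm] at ha
  linarith [dist_triangle (ρ (y a)) (y a) (y l), le_abs_self D₀, le_abs_self (L * s)]

end Morse

/-! ### The ping-pong criterion -/

section Criterion

variable {X : Type*} [MetricSpace X] {C : ℝ} {P : Set X} {ρ : X → X}

/-- If `p` is a nearest point to `x` in `Q`, and `w` is a point close to `Q` that is close to the
projection of a point `y` near `p` but far from `y`, then `w` is close to the projection of `x`. -/
theorem ContractsTo.dist_map_le_of_nearest (hX : IsGeodesicSpace X) (h : ContractsTo C P ρ)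
    {Q : Set X} {x p y w : X} {D K K' : ℝ} (hp : ∀ s ∈ Q, dist x p ≤ dist x s)
    (hpy : dist p y ≤ D) (hyw : dist (ρ y) w ≤ K) (hw : ∃ s ∈ Q, dist s w ≤ K')
    (hfar : D + 4 * C + 2 * K + K' < dist y w) : dist (ρ x) w ≤ K + 2 * C := by
  obtain ⟨s, hs, hsw⟩ := hw
  have hC := h.nonneg x
  have hK : 0 ≤ K := dist_nonneg.trans hyw
  have hK' : 0 ≤ K' := dist_nonneg.trans hsw
  have h1 : dist (ρ y) (ρ p) ≤ C := by
    by_contra! hlt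
    obtain ⟨R, hR⟩ := hX y p
    obtain ⟨z, hz, hzd⟩ := h.exists_near y p hlt R hR
    have := hR.dist_left_le hz
    rw [dist_comm y p] at this
    linarith [dist_triangle4 y z (ρ y) w]
  have h2 : dist (ρ p) w ≤ K + C := by
    rw [dist_comm] at h1
    linarith [dist_triangle (ρ p) (ρ y) w]
  -- Otherwise a geodesic from `p` to `x` passes near `w`, hence near `Q`; as `p` is nearest to `x`,
  -- it must be near `w` too, and so must `y`, against `hfar`.
  have h3 : dist (ρ x) (ρ p) ≤ C := by
    by_contra! hlt
    obtain ⟨R, hR⟩ := hX p x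
    obtain ⟨z, hz, hzd⟩ := h.exists_near p x (by rwa [dist_comm]) R hR
    have e1 := hR.dist_add hz
    have e2 := hp s hs
    have e3 := dist_triangle z (ρ p) w
    have e4 := dist_triangle4 x z w s
    have e5 := dist_triangle4 y p z w
    rw [dist_comm w s] at e4
    rw [dist_comm x p, dist_comm x z] at *
    rw [dist_comm y p] at e5
    linarith
  linarith [dist_triangle (ρ x) (ρ p) w]

variable {G : Type*} [Group G] [MulAction G X] [IsIsometricSMul G X] {o t : X} {h : G} {K : ℝ}

/-- After translation by `h ^ (-l)` the endpoints have exponents `≤ 0` and `≥ 1`, so they project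
near `o` and `t`. -/
theorem exists_near_translate (hρ : ContractsTo C P ρ)
    (hneg : ∀ i : ℤ, i ≤ 0 → dist (ρ (h ^ i • o)) o ≤ K)
    (hpos : ∀ i : ℤ, 1 ≤ i → dist (ρ (h ^ i • o)) t ≤ K) (hbig : 2 * K + C < dist o t)
    {i j l : ℤ} (hil : i ≤ l) (hlj : l < j) {Q : Set X}
    (hQ : IsGeodesicSegment Q (h ^ i • o) (h ^ j • o)) :
    (∃ z ∈ Q, dist z (h ^ l • o) ≤ C + K) ∧ ∃ z ∈ Q, dist z (h ^ l • t) ≤ C + K := by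
  have hQ' := hQ.smul (h ^ (-l))
  rw [smul_smul, smul_smul, ← zpow_add, ← zpow_add] at hQ'
  have h1 := hneg (-l + i) (by omega)
  have h2 := hpos (-l + j) (by omega)
  have h3 : C < dist (ρ (h ^ (-l + i) • o)) (ρ (h ^ (-l + j) • o)) := by
    have := dist_triangle4 o (ρ (h ^ (-l + i) • o)) (ρ (h ^ (-l + j) • o)) t
    rw [dist_comm o (ρ _)] at this
    linarith
  constructor
  · obtain ⟨_, ⟨z, hz, rfl⟩, hd⟩ := hρ.exists_near _ _ h3 _ hQ'
    refine ⟨z, hz, ?_⟩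
    rw [← dist_smul (h ^ (-l)), smul_smul (h ^ (-l)) (h ^ l), ← zpow_add, neg_add_cancel, zpow_zero,
      one_smul]
    exact (dist_triangle _ _ _).trans (add_le_add hd h1)
  · obtain ⟨_, ⟨z, hz, rfl⟩, hd⟩ := hρ.exists_near _ _ (by rwa [dist_comm]) _ hQ'.symm
    refine ⟨z, hz, ?_⟩
    rw [← dist_smul (h ^ (-l)), smul_smul (h ^ (-l)) (h ^ l), ← zpow_add, neg_add_cancel, zpow_zero,
      one_smul]
    exact (dist_triangle _ _ _).trans (add_le_add hd h2)

/-- Geodesics pass within `C + K` of intermediate orbit points, so each step adds at least `dist o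
(h • o) - 2 * (C + K) ≥ 1`. -/
theorem dist_zpow_smul_ge (hX : IsGeodesicSpace X) (hρ : ContractsTo C P ρ)
    (hneg : ∀ i : ℤ, i ≤ 0 → dist (ρ (h ^ i • o)) o ≤ K)
    (hpos : ∀ i : ℤ, 1 ≤ i → dist (ρ (h ^ i • o)) t ≤ K)
    (hbig : 5 * C + 4 * K + 1 < dist o t) (a : ℤ) (n : ℕ) :
    (n : ℝ) ≤ dist (h ^ a • o) (h ^ (a + n) • o) := by
  have hC := hρ.nonneg o
  have hK : 0 ≤ K := dist_nonneg.trans (hneg 0 le_rfl)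
  have hstep : 2 * C + 2 * K + 1 ≤ dist o (h • o) := by
    have h1 := hneg 0 le_rfl
    have h2 := hpos 1 le_rfl
    rw [zpow_zero, one_smul] at h1
    rw [zpow_one] at h2
    have h3 := hρ.dist_map_le hX o (h • o)
    have := dist_triangle4 o (ρ o) (ρ (h • o)) t
    rw [dist_comm o (ρ o)] at this
    linarith
  induction n with
  | zero => simp
  | succ n ih =>
    obtain ⟨Q, hQ⟩ := hX (h ^ a • o) (h ^ (a + (n + 1 : ℕ)) • o)
    obtain ⟨⟨z, hz, hzd⟩, -⟩ := exists_near_translate (l := a + n) hρ hneg hpos (by linarith)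
      (by omega) (by push_cast; omega) hQ
    have h1 := hQ.dist_add hz
    have h2 : dist (h ^ (a + n) • o) (h ^ (a + (n + 1 : ℕ)) • o) = dist o (h • o) := by
      rw [show a + ((n + 1 : ℕ) : ℤ) = a + n + 1 by push_cast; ring, zpow_add_one, mul_smul,
        dist_smul]
    have h3 := dist_triangle (h ^ a • o) z (h ^ (a + n) • o)
    have h4 := dist_triangle (h ^ (a + n) • o) z (h ^ (a + (n + 1 : ℕ)) • o)
    rw [dist_comm _ z] at h4
    push_cast at *
    linarith

theorem dist_zpow_smul_le (h : G) (o : X) (i j : ℤ) :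
    dist (h ^ i • o) (h ^ j • o) ≤ |(i : ℝ) - j| * dist o (h • o) := by
  have key : ∀ (a : ℤ) (n : ℕ), dist (h ^ a • o) (h ^ (a + n) • o) ≤ n * dist o (h • o) := by
    intro a n
    induction n with
    | zero => simp
    | succ n ih =>
      have h2 : dist (h ^ (a + n) • o) (h ^ (a + (n + 1 : ℕ)) • o) = dist o (h • o) := by
        rw [show a + ((n + 1 : ℕ) : ℤ) = a + n + 1 by push_cast; ring, zpow_add_one, mul_smul,
          dist_smul]
      have := dist_triangle (h ^ a • o) (h ^ (a + n) • o) (h ^ (a + (n + 1 : ℕ)) • o)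
      push_cast at *
      linarith
  rcases le_total i j with hij | hij
  · obtain ⟨n, rfl⟩ := Int.le.dest hij
    simpa using key i n
  · obtain ⟨n, rfl⟩ := Int.le.dest hij
    rw [dist_comm]
    simpa using key j n

end Criterion

section Criterion

variable {X : Type*} [MetricSpace X] {C : ℝ} {P : Set X} {ρ : X → X}
  {G : Type*} [Group G] [MulAction G X] [IsIsometricSMul G X] {o t : X} {h : G} {K : ℝ}

/-- The translate of `P` by `h ^ l` separates `x` from `y`: the margin `r` forces their projections
near its two ends, so `R` must pass close to it. -/
theorem exists_near_zpow_of_nearest (hX : IsGeodesicSpace X) (hρ : ContractsTo C P ρ)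
    (hneg : ∀ i : ℤ, i ≤ 0 → dist (ρ (h ^ i • o)) o ≤ K)
    (hpos : ∀ i : ℤ, 1 ≤ i → dist (ρ (h ^ i • o)) t ≤ K)
    (hbig : 5 * C + 4 * K + 1 < dist o t) {D : ℝ} {r : ℕ} (hr : 0 < r)
    (hrD : D + 5 * C + 3 * K + dist o t < r) {i j a b l : ℤ} (hia : i ≤ a) (hal : a + r ≤ l)
    (hlb : l + r ≤ b) (hbj : b ≤ j) {Q : Set X} (hQ : IsGeodesicSegment Q (h ^ i • o) (h ^ j • o))
    {x y p q : X} (hp : ∀ s ∈ Q, dist x p ≤ dist x s) (hq : ∀ s ∈ Q, dist y q ≤ dist y s)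
    (hpa : dist p (h ^ a • o) ≤ D) (hqb : dist q (h ^ b • o) ≤ D) {R : Set X}
    (hR : IsGeodesicSegment R x y) : ∃ z ∈ R, dist z (h ^ l • o) ≤ K + 3 * C := by
  have hC := hρ.nonneg o
  have hK : 0 ≤ K := dist_nonneg.trans (hneg 0 le_rfl)
  have hρl := hρ.smul (h ^ l)
  obtain ⟨hnear₁, hnear₂⟩ := exists_near_translate (l := l) hρ hneg hpos (by linarith) (by omega)
    (by omega) hQ
  have hcancel : ∀ c : ℤ, (h ^ l)⁻¹ • h ^ c • o = h ^ (c - l) • o := by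
    intro c
    rw [smul_smul, ← zpow_neg, ← zpow_add, neg_add_eq_sub]
  have hx := hρl.dist_map_le_of_nearest hX (y := h ^ a • o) (K := K) hp hpa
    (by rw [dist_smul, hcancel]; exact hneg _ (by omega)) hnear₁ (by
      obtain ⟨n, hn⟩ := Int.le.dest (show a ≤ l by omega)
      have h1 := dist_zpow_smul_ge hX hρ hneg hpos hbig a n
      have h2 : (r : ℝ) ≤ n := by exact_mod_cast (by omega : r ≤ n)
      rw [hn] at h1
      linarith [dist_nonneg (x := o) (y := t)])
  have hy := hρl.dist_map_le_of_nearest hX (y := h ^ b • o) (K := K) hq hqb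
    (by rw [dist_smul, hcancel]; exact hpos _ (by omega)) hnear₂ (by
      obtain ⟨n, hn⟩ := Int.le.dest (show l ≤ b by omega)
      have h1 := dist_zpow_smul_ge hX hρ hneg hpos hbig l n
      have h2 : (r : ℝ) ≤ n := by exact_mod_cast (by omega : r ≤ n)
      rw [hn] at h1
      have h3 := dist_triangle (h ^ l • o) (h ^ l • t) (h ^ b • o)
      rw [dist_smul, dist_comm (h ^ l • t)] at h3
      linarith)
  have hlt : dist (h ^ l • o) (h ^ l • t) = dist o t := dist_smul _ _ _
  obtain ⟨z, hz, hzd⟩ := hρl.exists_near x y (by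
    have := dist_triangle4 (h ^ l • o) (h ^ l • ρ ((h ^ l)⁻¹ • x)) (h ^ l • ρ ((h ^ l)⁻¹ • y))
      (h ^ l • t)
    rw [dist_comm (h ^ l • o) (h ^ l • ρ _)] at this
    linarith) R hR
  exact ⟨z, hz, by linarith [dist_triangle z (h ^ l • ρ ((h ^ l)⁻¹ • x)) (h ^ l • o)]⟩

/-- A ping-pong criterion: `h` is strongly contracting if a contracting projection separates
the non-positive part of its orbit from the positive part by a long distance. -/
theorem isStronglyContracting_of_separates (hX : IsGeodesicSpace X) (hρ : ContractsTo C P ρ)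
    (hneg : ∀ i : ℤ, i ≤ 0 → dist (ρ (h ^ i • o)) o ≤ K)
    (hpos : ∀ i : ℤ, 1 ≤ i → dist (ρ (h ^ i • o)) t ≤ K)
    (hbig : 5 * C + 4 * K + 1 < dist o t) : IsStronglyContracting o h := by
  have hC := hρ.nonneg o
  have hK : 0 ≤ K := dist_nonneg.trans (hneg 0 le_rfl)
  set s := dist o (h • o) with hs
  have hs0 : 0 ≤ s := dist_nonneg
  set D := s + 2 * (C + K) with hD
  obtain ⟨r, hrD⟩ := exists_nat_gt (D + 5 * C + 3 * K + dist o t)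
  have hr' : (0 : ℝ) < r := by
    linarith [dist_nonneg (x := o) (y := t)]
  have hr : 0 < r := by exact_mod_cast hr'
  set C' := 3 * D + 3 * r * s + K + 3 * C + 1 with hC'
  have hrs : 0 ≤ r * s := by positivity
  have main : ∀ (i j : ℤ) (Q : Set X), i ≤ j → IsGeodesicSegment Q (h ^ i • o) (h ^ j • o) →
      ∃ π : X → Q, IsContractingProjection C' Q π := by
    intro i j Q hij hQ
    have hcover : ∀ p ∈ Q, ∃ a : ℤ, i ≤ a ∧ a ≤ j ∧ dist p (h ^ a • o) ≤ D := by
      intro p hp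
      obtain ⟨n, rfl⟩ := Int.le.dest hij
      obtain ⟨l, hl, hd⟩ := IsGeodesicSegment.exists_dist_path_le
        (y := fun l : ℕ => h ^ (i + l) • o) (n := n) (D := C + K) hs0 (by simpa using hQ)
        (by
          intro l hl
          rcases hl.lt_or_eq with hl | rfl
          · exact (exists_near_translate hρ hneg hpos (by linarith) (by omega)
              (by omega) hQ).1
          · exact ⟨_, hQ.right_mem, by rw [dist_self]; linarith⟩)
        (by
          intro l hl
          have := dist_zpow_smul_le h o (i + l) (i + (l + 1 : ℕ))
          simpa [← hs] using this) hp
      exact ⟨i + l, by omega, by omega, hd⟩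
    have hproj : ∀ x, ∃ p ∈ Q, ∀ s ∈ Q, dist x p ≤ dist x s := by
      intro x
      obtain ⟨p, hp, hd⟩ := hQ.isCompact.exists_infDist_eq_dist ⟨_, hQ.left_mem⟩ x
      exact ⟨p, hp, fun s hs => hd ▸ Metric.infDist_le_dist_of_mem hs⟩
    -- The contracting projection is a nearest-point map.
    choose ν hνmem hν using hproj
    refine ContractsTo.exists_isContractingProjection (ρ := ν) ⟨hνmem, ?_, ?_⟩
    · intro a ha
      have := hν a a ha
      rw [dist_self] at this
      linarith
    · intro x y hxy R hR
      obtain ⟨a, hia, haj, hpa⟩ := hcover _ (hνmem x)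
      obtain ⟨b, hib, hbj, hqb⟩ := hcover _ (hνmem y)
      -- Two margins of `r` leave room for an exponent at distance exactly `r` from `a` and at least
      -- `r` from `b`.
      have hab : (2 * r : ℝ) < |(a : ℝ) - b| := by
        by_contra! hle
        have h1 := dist_zpow_smul_le h o a b
        have h2 : |(a : ℝ) - b| * s ≤ 2 * r * s := by gcongr
        have h3 := dist_triangle4 (ν x) (h ^ a • o) (h ^ b • o) (ν y)
        rw [dist_comm (h ^ b • o)] at h3
        linarith
      have hab' : (2 * r : ℤ) < |a - b| := by exact_mod_cast hab
      have hfin : ∀ l : ℤ, |(l : ℝ) - a| = r → ∀ z, dist z (h ^ l • o) ≤ K + 3 * C →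
          dist z (ν x) ≤ C' := by
        intro l hl z hz
        have h1 := dist_zpow_smul_le h o l a
        rw [hl] at h1
        have h2 := dist_triangle4 z (h ^ l • o) (h ^ a • o) (ν x)
        rw [dist_comm (h ^ a • o) (ν x)] at h2
        linarith
      rcases le_total a b with hle | hle
      · rw [abs_of_nonpos (by omega)] at hab'
        obtain ⟨z, hz, hzd⟩ := exists_near_zpow_of_nearest (l := a + r) hX hρ hneg hpos hbig hr hrD
          hia (by omega) (by omega) hbj hQ (hν x) (hν y) hpa hqb hR
        exact ⟨z, hz, hfin _ (by simp) z hzd⟩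
      · rw [abs_of_nonneg (by omega)] at hab'
        obtain ⟨z, hz, hzd⟩ := exists_near_zpow_of_nearest (l := a - r) hX hρ hneg hpos hbig hr hrD
          hib (by omega) (by omega) haj hQ (hν y) (hν x) hqb hpa hR.symm
        exact ⟨z, hz, hfin _ (by simp) z hzd⟩
  refine ⟨C', by linarith, ⟨s + 1, 0, by linarith, le_rfl, fun i j => ⟨?_, ?_⟩⟩, ?_⟩
  · have key : ∀ (a : ℤ) (n : ℕ), (n : ℝ) / (s + 1) ≤ dist (h ^ a • o) (h ^ (a + n) • o) :=
      fun a n => (div_le_self (by positivity) (by linarith)).trans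
        (dist_zpow_smul_ge hX hρ hneg hpos hbig a n)
    rw [sub_zero]
    rcases le_total i j with hij | hij
    · obtain ⟨n, rfl⟩ := Int.le.dest hij
      simpa using key i n
    · obtain ⟨n, rfl⟩ := Int.le.dest hij
      rw [dist_comm]
      simpa using key j n
  · refine (dist_zpow_smul_le h o i j).trans ?_
    rw [← hs]
    nlinarith [abs_nonneg ((i : ℝ) - j)]
  · intro i j Q hQ
    rcases le_total i j with hij | hij
    · exact main i j Q hij hQ
    · exact main j i Q hij hQ.symm

end Criterion

/-! ### Axes and their translates -/

/-- The element `g` commensurates the cyclic subgroup generated by `f`, in the strong sense that it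
conjugates a nontrivial power of `f` to a nontrivial power of `f`. -/
def CommensuratesZPowers {G : Type*} [Group G] (f g : G) : Prop :=
  ∃ a b : ℤ, a ≠ 0 ∧ b ≠ 0 ∧ g * f ^ a * g⁻¹ = f ^ b

theorem CommensuratesZPowers.inv {G : Type*} [Group G] {f g : G} (h : CommensuratesZPowers f g) :
    CommensuratesZPowers f g⁻¹ := by
  obtain ⟨a, b, ha, hb, h⟩ := h
  refine ⟨b, a, hb, ha, ?_⟩
  rw [← h]
  group

section Axis

variable {X : Type*} [MetricSpace X] {G : Type*} [Group G] [MulAction G X]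
  {o : X} {f : G} {C : ℝ}

theorem IsQuasiGeodesic.exists_lt_dist (hf : IsQuasiGeodesic (fun i : ℤ => f ^ i • o)) (L : ℝ) :
    ∃ N : ℕ, ∀ k : ℤ, (N : ℝ) ≤ |(k : ℝ)| → L < dist o (f ^ k • o) := by
  obtain ⟨l, e, hl, he, h⟩ := hf
  obtain ⟨N, hN⟩ := exists_nat_gt (l * (L + e))
  refine ⟨N, fun k hk => ?_⟩
  have h1 := (h 0 k).1
  simp only [zpow_zero, one_smul, Int.cast_zero, zero_sub, abs_neg] at h1
  have h2 : L + e < |(k : ℝ)| / l := by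
    rw [lt_div_iff₀ (by linarith)]
    linarith
  linarith

theorem IsQuasiGeodesic.zpow_injective (hf : IsQuasiGeodesic (fun i : ℤ => f ^ i • o)) :
    Function.Injective (fun i : ℤ => f ^ i) := by
  have key : ∀ k : ℤ, f ^ k = 1 → k = 0 := by
    intro k hk
    by_contra hk0
    obtain ⟨N, hN⟩ := hf.exists_lt_dist 0
    have h1 := hN (k * N) (by
      push_cast
      rw [abs_mul, Nat.abs_cast]
      have : (1 : ℝ) ≤ |(k : ℝ)| := by exact_mod_cast Int.one_le_abs hk0
      nlinarith [Nat.cast_nonneg (α := ℝ) N])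
    rw [zpow_mul, hk, one_zpow, one_smul, dist_self] at h1
    exact lt_irrefl _ h1
  intro i j hij
  have := key (i - j) (by rw [zpow_sub, mul_inv_eq_one]; exact hij)
  omega

theorem IsStronglyContractingWith.exists_contractsTo (hf : IsStronglyContractingWith C o f)
    {k : ℤ} {P : Set X} (hP : IsGeodesicSegment P o (f ^ k • o)) : ∃ ρ, ContractsTo C P ρ := by
  obtain ⟨π, hπ⟩ := hf.2 0 k P (by simpa using hP)
  exact ⟨_, hπ.contractsTo⟩

theorem IsStronglyContractingWith.exists_axis_near (hX : IsGeodesicSpace X)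
    [IsIsometricSMul G X] (hf : IsStronglyContractingWith C o f) :
    ∃ D : ℝ, 0 ≤ D ∧ ∀ (k : ℤ) (P : Set X), IsGeodesicSegment P o (f ^ k • o) →
      ∀ p ∈ P, ∃ i : ℤ, dist p (f ^ i • o) ≤ D := by
  obtain ⟨l, e, hl, he, hq⟩ := hf.1
  set s := dist o (f • o) with hs
  have hs0 : 0 ≤ s := dist_nonneg
  obtain ⟨D, hD0, hD⟩ := exists_morse_constant hX C l e s hl
  refine ⟨s + 2 * D, by positivity, fun k P hP p hp => ?_⟩
  obtain ⟨ρ, hρ⟩ := hf.exists_contractsTo hP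
  -- The sign `u` lets one path indexed by `ℕ` serve both signs of `k`.
  have key : ∀ (u : ℤ) (n : ℕ), |u| = 1 → k = u * n → ∃ i : ℤ, dist p (f ^ i • o) ≤ s + 2 * D := by
    rintro u n hu rfl
    have hu' : |(u : ℝ)| = 1 := by exact_mod_cast hu
    set y : ℕ → X := fun l => f ^ (u * l) • o with hy
    have h0 : y 0 = o := by simp [hy]
    have hys : ∀ l, dist (y l) (y (l + 1)) ≤ s := by
      intro l
      refine (dist_zpow_smul_le f o _ _).trans ?_
      push_cast
      rw [← mul_sub, abs_mul, hu']
      simp [hs]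
    have hyl : ∀ a b : ℕ, a ≤ b → ((b : ℝ) - a) / l - e ≤ dist (y a) (y b) := by
      intro a b hab
      have h1 := (hq (u * a) (u * b)).1
      push_cast at h1
      have hab' : (a : ℝ) ≤ b := by exact_mod_cast hab
      rw [← mul_sub, abs_mul, hu', one_mul, abs_sub_comm, abs_of_nonneg (by linarith)] at h1
      exact h1
    have hPy : IsGeodesicSegment P (y 0) (y n) := by rwa [h0]
    obtain ⟨l, -, hl⟩ := hPy.exists_dist_path_le hs0
      (hD P ρ hρ y hys hyl n hPy.left_mem hPy.right_mem) (fun l _ => hys l) hp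
    exact ⟨_, hl⟩
  obtain ⟨n, rfl | rfl⟩ := Int.eq_nat_or_neg k
  · exact key 1 n (by simp) (by simp)
  · exact key (-1) n (by simp) (by simp)

theorem finite_setOf_dist_smul_le [ProperSpace X] [ProperlyDiscontinuousSMul G X] (o : X) (R : ℝ) :
    {g : G | dist o (g • o) ≤ R}.Finite := by
  refine (ProperlyDiscontinuousSMul.finite_disjoint_inter_image (Γ := G)
    (isCompact_closedBall o |R|) (isCompact_closedBall o |R|)).subset ?_
  intro g hg
  refine ⟨g • o, ⟨o, ?_, rfl⟩, ?_⟩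
  · simp
  · rw [Metric.mem_closedBall, dist_comm]
    exact le_trans hg (le_abs_self R)

variable [IsIsometricSMul G X] [ProperSpace X] [ProperlyDiscontinuousSMul G X]

/-- By proper discontinuity the elements `(f ^ i)⁻¹ * g * f ^ j` fall in a finite set; a coincidence
between two of them conjugates a power of `f` to a power of `f`. -/
theorem finite_setOf_near_translate (hf : IsQuasiGeodesic (fun i : ℤ => f ^ i • o)) {g : G}
    (hg : ¬ CommensuratesZPowers f g) (R : ℝ) :
    {i : ℤ | ∃ j : ℤ, dist (f ^ i • o) (g • f ^ j • o) ≤ R}.Finite := by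
  by_contra hinf
  have hinf' : {i : ℤ | ∃ j : ℤ, dist (f ^ i • o) (g • f ^ j • o) ≤ R}.Infinite := hinf
  choose! j hj using fun (i : ℤ) (hi : ∃ j : ℤ, dist (f ^ i • o) (g • f ^ j • o) ≤ R) => hi
  obtain ⟨i, -, i', -, hne, heq⟩ := hinf'.exists_ne_map_eq_of_mapsTo
    (f := fun i => (f ^ i)⁻¹ * g * f ^ j i) (fun i hi => by
      have := hj i hi
      rw [← dist_smul (f ^ i)⁻¹, inv_smul_smul, smul_smul, smul_smul] at this
      exact this) (finite_setOf_dist_smul_le (G := G) o R)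
  have hb : i - i' ≠ 0 := sub_ne_zero.mpr hne
  have hconj : g * f ^ (j i - j i') * g⁻¹ = f ^ (i - i') := by
    have h1 : g * f ^ j i = f ^ i * ((f ^ i')⁻¹ * g * f ^ j i') := by
      rw [← heq]
      group
    rw [zpow_sub, ← mul_assoc, h1, zpow_sub]
    group
  refine hg ⟨_, _, ?_, hb, hconj⟩
  intro h0
  rw [h0, zpow_zero, mul_one, mul_inv_cancel] at hconj
  exact hb (hf.zpow_injective (by simpa using hconj.symm))

/-- Translates of axis segments by elements outside of the elementary closure have uniformly
bounded projections. -/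
theorem IsStronglyContractingWith.exists_dist_proj_le (hX : IsGeodesicSpace X)
    (hf : IsStronglyContractingWith C o f) {g : G} (hg : ¬ CommensuratesZPowers f g) :
    ∃ K : ℝ, ∀ (k : ℤ) (P : Set X) (ρ : X → X), IsGeodesicSegment P o (f ^ k • o) →
      ContractsTo C P ρ → ∀ x ∈ P, dist (ρ (g • x)) o ≤ K := by
  obtain ⟨D, hD0, hD⟩ := hf.exists_axis_near hX
  have hfin := finite_setOf_near_translate hf.1 hg (2 * D + C)
  obtain ⟨B, hB⟩ := (hfin.image (fun i => dist (f ^ i • o) o)).bddAbove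
  -- Beyond the first bound, `g • P` must pass near `ρ (g • x)`, making some `f ^ i • o` near the
  -- translated axis; `B` bounds all such `f ^ i • o`.
  refine ⟨max (2 * dist o (g • o) + 3 * C) (B + D), fun k P ρ hP hρ x hx => ?_⟩
  by_contra! hlt
  obtain ⟨hlt1, hlt2⟩ := max_lt_iff.mp hlt
  have hgo := hρ.dist_map_mem_le hX (g • o) hP.left_mem
  rw [dist_comm (g • o)] at hgo
  have hfar : C < dist (ρ (g • x)) (ρ (g • o)) := by
    linarith [dist_triangle (ρ (g • x)) (ρ (g • o)) o]
  obtain ⟨Q, hQP, hQ⟩ := hP.exists_subsegment hx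
  obtain ⟨_, ⟨w, hw, rfl⟩, hwd⟩ := hρ.exists_near _ _ hfar _ (hQ.smul g).symm
  obtain ⟨j, hj⟩ := hD k P hP w (hQP hw)
  obtain ⟨i, hi⟩ := hD k P hP _ (hρ.mem (g • x))
  rw [← dist_smul g] at hj
  simp only at hwd
  have h1 : dist (f ^ i • o) (g • f ^ j • o) ≤ 2 * D + C := by
    have := dist_triangle4 (f ^ i • o) (ρ (g • x)) (g • w) (g • f ^ j • o)
    rw [dist_comm (f ^ i • o) (ρ _), dist_comm (ρ (g • x)) (g • w)] at this
    linarith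
  have h2 : dist (f ^ i • o) o ≤ B := hB ⟨i, ⟨j, h1⟩, rfl⟩
  linarith [dist_triangle (ρ (g • x)) (f ^ i • o) o]

end Axis

/-! ### The Behrstock inequality and commutators -/

section Step

variable {X : Type*} [MetricSpace X] {G : Type*} [Group G] [MulAction G X] [IsIsometricSMul G X]
  {o t : X} {g : G} {C K₀ K : ℝ} {P : Set X} {ρ : X → X}

/-- A Behrstock-type inequality: if `g • x` projects far from `o`, then `x` projects
close to `o`. -/
theorem ContractsTo.dist_map_le_of_smul (hX : IsGeodesicSpace X) (hρ : ContractsTo C P ρ)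
    (ho : o ∈ P) (hg : ∀ x ∈ P, dist (ρ (g • x)) o ≤ K₀)
    (hK : K = 2 * (K₀ + C + dist o (g • o)) + 2 * C) (hfar : K + K₀ + C < dist o t) {x : X}
    (hx : dist (ρ (g • x)) t ≤ K) : dist (ρ x) o ≤ K := by
  have h1 := hg (ρ x) (hρ.mem x)
  have h2 : C < dist (ρ (g • ρ x)) (ρ (g • x)) := by
    have := dist_triangle4 o (ρ (g • ρ x)) (ρ (g • x)) t
    rw [dist_comm o (ρ _)] at this
    linarith
  -- This geodesic passes near `o`, hence near `g • o`. As `ρ x` is almost nearest to `x`, it is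
  -- then close to `o`.
  obtain ⟨R, hR⟩ := hX (g • ρ x) (g • x)
  obtain ⟨w, hw, hwd⟩ := hρ.exists_near _ _ h2 R hR
  have h3 := hR.dist_add hw
  have h4 := hρ.dist_self_le hX x ho
  have h5 := dist_triangle (g • x) w (g • o)
  have h6 := dist_triangle4 w (ρ (g • ρ x)) o (g • o)
  have h7 := dist_triangle (g • ρ x) w (g • o)
  rw [dist_smul] at h3 h5 h7
  rw [dist_comm (ρ x) x] at h3
  rw [dist_comm (g • x) w] at h5
  linarith

end Step

section Commutator

variable {X : Type*} [MetricSpace X] {G : Type*} [Group G] [MulAction G X] [IsIsometricSMul G X]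
  [ProperSpace X] [ProperlyDiscontinuousSMul G X] {o : X} {f : G} {C : ℝ}

/-- The commutator of a large power of a strongly contracting element `f` with an element outside
of the elementary closure of `f` is strongly contracting. -/
theorem IsStronglyContractingWith.exists_commutator (hX : IsGeodesicSpace X)
    (hf : IsStronglyContractingWith C o f) {m : G} (hm : ¬ CommensuratesZPowers f m) :
    ∃ k : ℤ, IsStronglyContracting o (f ^ k * m * (f ^ k)⁻¹ * m⁻¹) := by
  have hm' : ¬ CommensuratesZPowers f m⁻¹ := fun h => hm (by simpa using h.inv)
  obtain ⟨K₁, hK₁⟩ := hf.exists_dist_proj_le hX hm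
  obtain ⟨K₂, hK₂⟩ := hf.exists_dist_proj_le hX hm'
  set K₀ : ℝ := max (max K₁ K₂) 0 with hK₀
  have hK₁₀ : K₁ ≤ K₀ := (le_max_left _ _).trans (le_max_left _ _)
  have hK₂₀ : K₂ ≤ K₀ := (le_max_right _ _).trans (le_max_left _ _)
  have hK₀0 : 0 ≤ K₀ := le_max_right _ _
  set K : ℝ := 2 * (K₀ + C + dist o (m • o)) + 2 * C with hK
  have hdm : dist o (m⁻¹ • o) = dist o (m • o) := by
    rw [← dist_smul m, smul_inv_smul, dist_comm]
  obtain ⟨n, hn⟩ := hf.1.exists_lt_dist (5 * C + 4 * K + 1)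
  obtain ⟨k, hk⟩ : ∃ k : ℤ, k = n := ⟨_, rfl⟩
  have hbig : 5 * C + 4 * K + 1 < dist o (f ^ k • o) := hn k (by simp [hk])
  have hbig' : 5 * C + 4 * K + 1 < dist o (f ^ (-k) • o) := hn (-k) (by simp [hk])
  obtain ⟨P, hP⟩ := hX o (f ^ k • o)
  obtain ⟨ρ, hρ⟩ := hf.exists_contractsTo hP
  have hC : 0 ≤ C := hρ.nonneg o
  have hd0 : 0 ≤ dist o (m • o) := dist_nonneg
  have hP' := (hP.smul (f ^ (-k))).symm
  rw [smul_smul, ← zpow_add, neg_add_cancel, zpow_zero, one_smul] at hP'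
  have hρ' := hρ.smul (f ^ (-k))
  have stepA : ∀ g : G, (∀ x ∈ P, dist (ρ (g • x)) o ≤ K₀) → dist o (g • o) = dist o (m • o) →
      ∀ x, dist (ρ (g • x)) (f ^ k • o) ≤ K → dist (ρ x) o ≤ K := by
    intro g hg hd x hx
    exact hρ.dist_map_le_of_smul hX hP.left_mem hg (by rw [hK, hd]) (by linarith) hx
  -- The same inequality for the reversed segment from `o` to `f ^ (-k) • o`, carried back by `f ^
  -- k`.
  have stepB : ∀ g : G, (∀ x ∈ (fun p => f ^ (-k) • p) '' P,
      dist (f ^ (-k) • ρ ((f ^ (-k))⁻¹ • g • x)) o ≤ K₀) → dist o (g • o) = dist o (m • o) →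
      ∀ y, dist (ρ (f ^ k • g • y)) o ≤ K → dist (ρ (f ^ k • y)) (f ^ k • o) ≤ K := by
    intro g hg hd y hy
    have h1 := hρ'.dist_map_le_of_smul (x := y) hX hP'.left_mem hg (K := K) (t := f ^ (-k) • o)
      (by rw [hK, hd]) (by linarith) (by simpa using hy)
    rw [← dist_smul (f ^ k)] at h1
    simpa using h1
  have hA : ∀ x, dist (ρ (m • x)) (f ^ k • o) ≤ K → dist (ρ x) o ≤ K :=
    stepA m (fun x hx => (hK₁ k P ρ hP hρ x hx).trans hK₁₀) rfl
  have hA' : ∀ x, dist (ρ (m⁻¹ • x)) (f ^ k • o) ≤ K → dist (ρ x) o ≤ K :=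
    stepA m⁻¹ (fun x hx => (hK₂ k P ρ hP hρ x hx).trans hK₂₀) hdm
  have hB : ∀ y, dist (ρ (f ^ k • m • y)) o ≤ K → dist (ρ (f ^ k • y)) (f ^ k • o) ≤ K :=
    stepB m (fun x hx => (hK₁ (-k) _ _ hP' hρ' x hx).trans hK₁₀) rfl
  have hB' : ∀ y, dist (ρ (f ^ k • m⁻¹ • y)) o ≤ K → dist (ρ (f ^ k • y)) (f ^ k • o) ≤ K :=
    stepB m⁻¹ (fun x hx => (hK₂ (-k) _ _ hP' hρ' x hx).trans hK₂₀) hdm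
  set h : G := f ^ k * m * (f ^ k)⁻¹ * m⁻¹ with hh
  have hpos : ∀ x, dist (ρ (m⁻¹ • x)) o ≤ K → dist (ρ (h • x)) (f ^ k • o) ≤ K := by
    intro x hx
    have := hB' (m • (f ^ k)⁻¹ • m⁻¹ • x) (by simpa using hx)
    simpa [hh, mul_smul] using this
  have hneg : ∀ x, dist (ρ x) o ≤ K → dist (ρ (h⁻¹ • x)) o ≤ K := by
    intro x hx
    apply hA'
    have := hB (m⁻¹ • (f ^ k)⁻¹ • x) (by simpa using hx)
    simpa [hh, mul_smul] using this
  have hposn : ∀ n : ℕ, dist (ρ (h ^ (n + 1) • o)) (f ^ k • o) ≤ K := by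
    intro n
    induction n with
    | zero =>
      rw [zero_add, pow_one]
      apply hpos
      refine (hρ.dist_map_mem_le hX _ hP.left_mem).trans ?_
      rw [dist_comm, hdm]
      linarith
    | succ n ih =>
      rw [pow_succ', mul_smul]
      apply hpos
      apply hA
      rwa [smul_inv_smul]
  have hnegn : ∀ n : ℕ, dist (ρ ((h⁻¹) ^ n • o)) o ≤ K := by
    intro n
    induction n with
    | zero =>
      rw [pow_zero, one_smul, dist_comm]
      refine (hρ.dist_le o hP.left_mem).trans ?_
      linarith
    | succ n ih =>
      rw [pow_succ', mul_smul]
      exact hneg _ ih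
  refine ⟨k, isStronglyContracting_of_separates hX hρ (K := K) (t := f ^ k • o) ?_ ?_ hbig⟩
  · intro i hi
    obtain ⟨n, rfl⟩ := Int.exists_eq_neg_ofNat hi
    have := hnegn n
    rwa [inv_pow, ← zpow_natCast, ← zpow_neg] at this
  · intro i hi
    obtain ⟨n, rfl⟩ := Int.le.dest hi
    have := hposn n
    rwa [← zpow_natCast, Nat.cast_succ, add_comm] at this

end Commutator

/-! ### The elementary closure -/

theorem exists_mul_inv_eq_zpow {G : Type*} [Group G] {f : G} {Φ : Set G} (hΦ : Φ.Finite) {ι : Type*} {S : Set ι}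
    (hS : S.Infinite) (u : ι → G) (h : ∀ x ∈ S, ∃ i : ℤ, ∃ φ ∈ Φ, u x = f ^ i * φ) :
    ∃ x ∈ S, ∃ y ∈ S, x ≠ y ∧ ∃ c : ℤ, u x * (u y)⁻¹ = f ^ c := by
  choose! i φ hφ hu using h
  obtain ⟨x, hx, y, hy, hne, heq⟩ := hS.exists_ne_map_eq_of_mapsTo (f := φ) hφ hΦ
  refine ⟨x, hx, y, hy, hne, i x - i y, ?_⟩
  rw [hu x hx, hu y hy, heq, zpow_sub]
  group

section ElementaryClosure

variable {X : Type*} [MetricSpace X] {G : Type*} [Group G] [MulAction G X] [IsIsometricSMul G X]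
  {o : X} {f : G} {C : ℝ}

/-- For large `N`, `g` moves the ends of a segment `T` along the axis to points within `dist o (g •
o)` of the ends of `P`, so `g • T` passes near `P`. Only `N` depends on `g`; the bound does not. -/
theorem IsStronglyContractingWith.exists_commensurating_near (hX : IsGeodesicSpace X)
    (hf : IsStronglyContractingWith C o f) :
    ∃ R : ℝ, ∀ g : G, CommensuratesZPowers f g →
      ∃ i j : ℤ, dist (f ^ i • o) (g • f ^ j • o) ≤ R := by
  obtain ⟨D, hD0, hD⟩ := hf.exists_axis_near hX
  refine ⟨2 * D + C, ?_⟩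
  rintro g ⟨a, b, ha, hb, hab⟩
  obtain ⟨N, hN⟩ := hf.1.exists_lt_dist (4 * dist o (g • o) + 5 * C)
  have hbN := hN (b * N) (by
    push_cast
    rw [abs_mul, Nat.abs_cast]
    have : (1 : ℝ) ≤ |(b : ℝ)| := by exact_mod_cast Int.one_le_abs hb
    nlinarith [Nat.cast_nonneg (α := ℝ) N])
  have hconj : g • f ^ (a * N) • o = f ^ (b * N) • g • o := by
    rw [smul_smul, smul_smul, zpow_mul f b, ← hab, conj_zpow, ← zpow_mul]
    simp
  obtain ⟨P, hP⟩ := hX o (f ^ (b * N) • o)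
  obtain ⟨ρ, hρ⟩ := hf.exists_contractsTo hP
  obtain ⟨T, hT⟩ := hX o (f ^ (a * N) • o)
  have h1 := hρ.dist_map_mem_le hX (g • o) hP.left_mem
  have h2 := hρ.dist_map_mem_le hX (g • f ^ (a * N) • o) hP.right_mem
  rw [hconj, dist_smul, ← hconj, dist_comm (g • o)] at h2
  rw [dist_comm (g • o)] at h1
  have h3 := dist_triangle4 o (ρ (g • o)) (ρ (g • f ^ (a * N) • o)) (f ^ (b * N) • o)
  rw [dist_comm o (ρ _)] at h3
  have hC := hρ.nonneg o
  obtain ⟨_, ⟨w, hw, rfl⟩, hwd⟩ := hρ.exists_near _ _ (by linarith) _ (hT.smul g)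
  obtain ⟨i, hi⟩ := hD _ P hP _ (hρ.mem (g • o))
  obtain ⟨j, hj⟩ := hD _ T hT w hw
  rw [← dist_smul g] at hj
  simp only at hwd
  refine ⟨i, j, ?_⟩
  have := dist_triangle4 (f ^ i • o) (ρ (g • o)) (g • w) (g • f ^ j • o)
  rw [dist_comm (f ^ i • o) (ρ _), dist_comm (ρ (g • o)) (g • w)] at this
  linarith

variable [ProperSpace X] [ProperlyDiscontinuousSMul G X]

/-- The elementary closure of `f` is a finite union of cosets of the subgroup generated by `f`. -/
theorem IsStronglyContractingWith.exists_finite_cosets (hX : IsGeodesicSpace X)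
    (hf : IsStronglyContractingWith C o f) :
    ∃ Φ : Set G, Φ.Finite ∧ ∀ g : G, CommensuratesZPowers f g →
      ∃ i : ℤ, ∃ φ ∈ Φ, g = f ^ i * φ := by
  obtain ⟨R, hR⟩ := hf.exists_commensurating_near hX
  choose! a b ha hb hab using fun (g : G) (h : CommensuratesZPowers f g) => h
  refine ⟨⋃ γ ∈ {γ : G | dist o (γ • o) ≤ R}, (fun r : ℤ => γ * f ^ r) '' Set.Ico 0 |a γ|,
    (finite_setOf_dist_smul_le o R).biUnion fun γ _ => (Set.finite_Ico _ _).image _, ?_⟩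
  intro g hg
  obtain ⟨i, j, hij⟩ := hR g hg
  set γ := (f ^ i)⁻¹ * g * f ^ j with hγ
  have hγR : dist o (γ • o) ≤ R := by
    rw [← dist_smul (f ^ i)⁻¹, inv_smul_smul, smul_smul, smul_smul] at hij
    exact hij
  have hγc : CommensuratesZPowers f γ := by
    obtain ⟨c, d, hc, hd, hcd⟩ := hg
    refine ⟨c, d, hc, hd, ?_⟩
    have : γ * f ^ c * γ⁻¹ = (f ^ i)⁻¹ * (g * f ^ c * g⁻¹) * f ^ i := by
      rw [hγ]
      group
    rw [this, hcd]
    group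
  have hγab := hab γ hγc
  have hγa := ha γ hγc
  -- Write `g = f ^ i * γ * f ^ (-j)` and divide `-j` by `a γ`: the quotient part crosses `γ` as a
  -- power of `f ^ b γ`, leaving finitely many remainders.
  refine ⟨i + b γ * (-j / a γ), γ * f ^ (-j % a γ), Set.mem_biUnion hγR
    ⟨_, ⟨Int.emod_nonneg _ hγa, Int.emod_lt_abs _ hγa⟩, rfl⟩, ?_⟩
  have h1 : f ^ (b γ * (-j / a γ)) * γ = γ * f ^ (a γ * (-j / a γ)) := by
    rw [zpow_mul, ← hγab, conj_zpow, ← zpow_mul]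
    group
  have h2 : f ^ (a γ * (-j / a γ)) * f ^ (-j % a γ) = f ^ (-j) := by
    rw [← zpow_add, Int.mul_ediv_add_emod]
  rw [zpow_add, mul_assoc, ← mul_assoc _ γ, h1, mul_assoc γ, h2, hγ]
  group

theorem IsStronglyContractingWith.exists_not_commensurates (hX : IsGeodesicSpace X)
    (hf : IsStronglyContractingWith C o f) (hG : ¬ IsElementaryGroup G) :
    ∃ g : G, ¬ CommensuratesZPowers f g := by
  by_contra! hall
  obtain ⟨Φ, hΦ, h⟩ := hf.exists_finite_cosets hX
  refine hG (Or.inr ⟨Subgroup.zpowers f, ?_, inferInstance, ?_⟩)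
  · refine Infinite.of_injective (fun i : ℤ => (⟨f ^ i, i, rfl⟩ : Subgroup.zpowers f)) ?_
    intro i j hij
    exact hf.1.zpow_injective (congrArg Subtype.val hij)
  · have := hΦ.to_subtype
    have hsurj : Function.Surjective
        (fun φ : Φ => (QuotientGroup.mk (φ : G)⁻¹ : G ⧸ Subgroup.zpowers f)) := by
      intro q
      obtain ⟨g, rfl⟩ := QuotientGroup.mk_surjective q
      -- Inversion turns the right cosets given by `Φ` into the left cosets of the quotient.
      obtain ⟨i, φ, hφ, hg⟩ := h g⁻¹ (hall _)
      refine ⟨⟨φ, hφ⟩, ?_⟩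
      rw [QuotientGroup.eq, inv_inv]
      refine ⟨-i, ?_⟩
      rw [← inv_inv g, hg]
      group
    have := Finite.of_surjective _ hsurj
    exact Subgroup.finiteIndex_of_finite_quotient

/-- If all of `M` commensurates, then `M` contains some `f ^ c` with `c ≠ 0`, hence its conjugate by
any `g`. Two powers of that conjugate differ by a power of `f`, so every `g` commensurates, which
non-elementarity forbids. -/
theorem IsStronglyContractingWith.exists_mem_not_commensurates (hX : IsGeodesicSpace X)
    (hf : IsStronglyContractingWith C o f) (hG : ¬ IsElementaryGroup G) {M : Subgroup G}
    (hM : M.Normal) (hMinf : Infinite M) : ∃ m ∈ M, ¬ CommensuratesZPowers f m := by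
  by_contra! hall
  obtain ⟨g, hg⟩ := hf.exists_not_commensurates hX hG
  obtain ⟨Φ, hΦ, h⟩ := hf.exists_finite_cosets hX
  obtain ⟨x, hx, y, hy, hne, c, hc⟩ := exists_mul_inv_eq_zpow (S := (M : Set G)) hΦ
    (Set.infinite_coe_iff.mp hMinf) id (fun x hx => h x (hall x hx))
  have hc0 : c ≠ 0 := by
    rintro rfl
    rw [zpow_zero, mul_inv_eq_one] at hc
    exact hne hc
  have hu : g * f ^ c * g⁻¹ ∈ M := by
    rw [← hc]
    exact hM.conj_mem _ (M.mul_mem hx (M.inv_mem hy)) g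
  obtain ⟨p, -, q, -, hpq, d, hd⟩ := exists_mul_inv_eq_zpow (S := (Set.univ : Set ℤ)) hΦ
    Set.infinite_univ (fun p : ℤ => (g * f ^ c * g⁻¹) ^ p)
    (fun p _ => h _ (hall _ (M.zpow_mem hu p)))
  have hcpq : c * (p - q) ≠ 0 := mul_ne_zero hc0 (sub_ne_zero.mpr hpq)
  have hconj : g * f ^ (c * (p - q)) * g⁻¹ = f ^ d := by
    rw [← hd, ← zpow_sub, conj_zpow, zpow_mul]
  refine hg ⟨_, d, hcpq, ?_, hconj⟩
  rintro rfl
  rw [zpow_zero, mul_inv_eq_one, mul_eq_left] at hconj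
  exact hcpq (hf.1.zpow_injective (by simpa using hconj))

end ElementaryClosure

/-! ### Assembling the coordinates -/

/-- A normal subgroup of a product contains the commutators of its coordinates. -/
theorem Subgroup.mulSingle_commutator_mem {ι : Type*} [DecidableEq ι] {G : ι → Type*}
    [∀ i, Group (G i)] {N : Subgroup (∀ i, G i)} (hN : N.Normal) {x : ∀ i, G i} (hx : x ∈ N)
    (i : ι) (g : G i) : Pi.mulSingle i (g * x i * g⁻¹ * (x i)⁻¹) ∈ N := by
  have h := N.mul_mem (hN.conj_mem x hx (Pi.mulSingle i g)) (N.inv_mem hx)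
  convert h using 1
  ext j
  rcases eq_or_ne j i with rfl | hj
  · simp
  · simp [Pi.mulSingle_eq_of_ne hj]

theorem mainTheorem6 {n : ℕ} (G : Fin n → Type*) (X : Fin n → Type*)
    [∀ i, Group (G i)] [∀ i, MetricSpace (X i)] [∀ i, ProperSpace (X i)]
    [∀ i, MulAction (G i) (X i)] [∀ i, IsIsometricSMul (G i) (X i)]
    [∀ i, ProperlyDiscontinuousSMul (G i) (X i)]
    (hgeo : ∀ i, IsGeodesicSpace (X i))
    (hcocompact : ∀ i, CompactSpace (MulAction.orbitRel.Quotient (G i) (X i)))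
    (hne : ∀ i, ¬ IsElementaryGroup (G i))
    (o : ∀ i, X i)
    (hcontr : ∀ i, ∃ h : G i, IsStronglyContracting (o i) h)
    (N : Subgroup (∀ i, G i)) (hN : N.Normal) (hNinf : Infinite N)
    (hproj : ∀ i, Infinite (N.map (Pi.evalMonoidHom G i))) :
    ∃ h ∈ N, ∀ i, IsStronglyContracting (o i) (h i) := by
  have key : ∀ i, ∃ g : G i, IsStronglyContracting (o i) g ∧ Pi.mulSingle i g ∈ N := by
    intro i
    obtain ⟨f, C, -, hf⟩ := hcontr i
    have hnormal : (N.map (Pi.evalMonoidHom G i)).Normal :=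
      hN.map _ (Function.surjective_eval i)
    obtain ⟨_, ⟨x, hx, rfl⟩, hm⟩ :=
      hf.exists_mem_not_commensurates (hgeo i) (hne i) hnormal (hproj i)
    obtain ⟨k, hk⟩ := hf.exists_commutator (hgeo i) hm
    exact ⟨_, hk, Subgroup.mulSingle_commutator_mem hN hx i (f ^ k)⟩
  choose h hh hmem using key
  exact ⟨h, Subgroup.pi_mem_of_mulSingle_mem h hmem, hh⟩
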